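/- For each $n$ let $p=p(n)\in[0,1]$, and let $\mathcal G(n,p)$ be the Erdős–Rényi random graph on $n$ vertices, in which each of the $\binom n2$ possible edges is present independently with probability $p$. For a graph $\mathcal G$ on a set $\mathcal V$ of $n\ge 2$ vertices let $d_{\min}$ and $d_{\max}$ be its minimum and maximum degree, and let $$i(\mathcal G)=\min_{\emptyset\ne A\subset\mathcal V,\ |A|\le n/2}\frac{|\partial A|}{|A|}$$ be its isoperimetric constant, where $\partial A$ is the set of edges with one endpoint in $A$ and the other in $\mathcal V\setminus A$. Suppose that $$\limsup_{n\to\infty}\frac{\ln n}{np}<1$$ (where $\frac{\ln n}{np}$ is read as $+\infty$ if $p(n)=0$ and $n\ge 2$). Then there exists a constant $\alpha>0$, depending only on the function $p$, such that for every fixed $\epsilon\in(0,\tfrac12]$, $$\alpha np\le i(\mathcal G)\le d_{\min}\le d_{\max}\le np\left(1+\sqrt3\left(\frac{\ln n}{np}\right)^{\frac12-\epsilon}\right)$$ holds asymptotically almost surely, that is, the probability that $\mathcal G=\mathcal G(n,p)$ satisfies these four inequalities tends to $1$ as $n\to\infty$. -/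

import Mathlib

/-- The edge boundary `∂S` of a set `S` of vertices: all edges `(u, v)` with `u ∈ S` and `v ∉ S`.
Each boundary edge occurs exactly once, oriented from `S` to its complement. -/
noncomputable def SimpleGraph.edgeBoundary {V : Type*} [Fintype V] (G : SimpleGraph V)
    (S : Finset V) : Finset (V × V) :=
  open scoped Classical in Finset.univ.filter fun e => G.Adj e.1 e.2 ∧ e.1 ∈ S ∧ e.2 ∉ S

/-- The isoperimetric constant `i(G)`: the minimum of `|∂A| / |A|` over all nonempty sets `A` of at
most `n / 2` vertices, where `n` is the number of vertices. The infimum is over a finite set of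
reals, which is nonempty (so that the infimum is a minimum) as soon as `n ≥ 2`. -/
noncomputable def SimpleGraph.isoperimetricConstant {V : Type*} [Fintype V]
    (G : SimpleGraph V) : ℝ :=
  sInf {r : ℝ | ∃ A : Finset V, A.Nonempty ∧ (A.card : ℝ) ≤ (Fintype.card V : ℝ) / 2 ∧
    r = ((G.edgeBoundary A).card : ℝ) / (A.card : ℝ)}

/-- A graph property `P` holds asymptotically almost surely for the Erdős–Rényi random graph
`G(n, p)`, with `p = p n`, if its probability tends to `1` as `n → ∞`. -/
def AsymptoticallyAlmostSurely (p : ℕ → unitInterval)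
    (P : (n : ℕ) → SimpleGraph (Fin n) → Prop) : Prop :=
  Filter.Tendsto (fun n : ℕ => SimpleGraph.binomialRandom (Fin n) (p n) {G | P n G})
    Filter.atTop (nhds 1)

open MeasureTheory ProbabilityTheory Filter Topology

/-! For a fixed set A of k vertices, |∂A| is binomial with mean mk(1 - k/n), where m = np, and
degrees are the case k = 1. Chernoff bounds and union bounds therefore suffice; the hypothesis
enters as log n ≤ rm eventually, for some r < 1.

Maximum degree: with x = log n / m and d = √3 x^(1/2-ε), a vertex has degree at least m(1+d) with
probability at most exp(-md²/3) = exp(-x^(-2ε) log n). As x ≤ r, this is at most n^(-γ) with γ =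
r^(-2ε) > 1, which beats the n vertices.

Isoperimetric constant: for small c and t = -log c, the event |∂A| ≤ (c/t)mk has probability at most
q^k with q = n^(-ρ), ρ > 1, if k ≤ cn, and at most Q^n with Q = n^(-c/4) if cn ≤ k ≤ n/2. Over all
nonempty A these sum to at most (1+q)^n - 1 + (2Q)^n, which tends to 0. Finally i(G) ≤ d_min by
taking A a singleton. -/

theorem mgf_ncard_inter_setBernoulli {ι : Type*} [Finite ι] (p : unitInterval) {u E : Set ι}
    (hE : E ⊆ u) (t : ℝ) :
    mgf (fun s : Set ι => ((s ∩ E).ncard : ℝ)) (setBernoulli u p) t =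
      (1 + p * (Real.exp t - 1)) ^ E.ncard := by
  classical
  cases nonempty_fintype ι
  have hprod : ∀ s : Finset ι, ∏ i ∈ s, (if i ∈ E then Real.exp t else 1) =
      Real.exp (t * (((s : Set ι) ∩ E).ncard : ℝ)) := by
    intro s
    rw [Finset.prod_ite, Finset.prod_const, Finset.prod_const_one, mul_one, mul_comm,
      Real.exp_nat_mul, ← Set.ncard_coe_finset]
    congr 2
    ext i
    simp
  rw [mgf, integral_fintype .of_finite]
  have h1 : ∑ s : Set ι, (setBernoulli u p).real {s} • Real.exp (t * ((s ∩ E).ncard : ℝ)) =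
      ∑ s ∈ u.toFinset.powerset, (setBernoulli u p).real {(s : Set ι)} •
        Real.exp (t * (((s : Set ι) ∩ E).ncard : ℝ)) := by
    symm
    refine Finset.sum_of_injOn (fun s : Finset ι => (s : Set ι)) (by simp) (by simp) ?_ (by simp)
    intro s _ hs
    have hsu : ¬ s ⊆ u := by
      intro h
      refine hs ⟨s.toFinset, ?_, by simp⟩
      simpa using h
    simp [measureReal_def, setBernoulli_singleton_of_not_subset p hsu]
  rw [h1]
  have h2 : ∀ s ∈ u.toFinset.powerset, (setBernoulli u p).real {(s : Set ι)} •
        Real.exp (t * (((s : Set ι) ∩ E).ncard : ℝ)) =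
      (∏ i ∈ s, ((p : ℝ) * if i ∈ E then Real.exp t else 1)) *
        ∏ i ∈ u.toFinset \ s, (1 - p : ℝ) := by
    intro s hs
    have hsu : (s : Set ι) ⊆ u := by
      simpa using hs
    rw [setBernoulli_real_singleton p hsu u.toFinite, Finset.prod_mul_distrib, hprod,
      Finset.prod_const, Finset.prod_const, Set.ncard_coe_finset, ← Set.ncard_coe_finset (_ \ _)]
    simp only [Finset.coe_sdiff, Set.coe_toFinset, smul_eq_mul]
    ring
  rw [Finset.sum_congr rfl h2, ← Finset.prod_add]
  have h3 : ∀ i ∈ u.toFinset, ((p : ℝ) * (if i ∈ E then Real.exp t else 1) + (1 - p)) =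
      if i ∈ E then 1 + p * (Real.exp t - 1) else 1 := by
    intro i _
    split_ifs <;> ring
  rw [Finset.prod_congr rfl h3, Finset.prod_ite, Finset.prod_const, Finset.prod_const_one, mul_one,
    ← Set.ncard_coe_finset]
  congr 2
  ext i
  simpa using fun h => hE h

/-- By 1 + x ≤ exp x, the binomial generating function is dominated by that of the Poisson law of
the same mean, for t of either sign. -/
theorem mgf_ncard_inter_setBernoulli_le {ι : Type*} [Finite ι] (p : unitInterval) {u E : Set ι}
    (hE : E ⊆ u) (t : ℝ) :
    mgf (fun s : Set ι => ((s ∩ E).ncard : ℝ)) (setBernoulli u p) t ≤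
      Real.exp (p * E.ncard * (Real.exp t - 1)) := by
  rw [mgf_ncard_inter_setBernoulli p hE,
    show (p : ℝ) * E.ncard * (Real.exp t - 1) = E.ncard * (p * (Real.exp t - 1)) by ring,
    Real.exp_nat_mul]
  have h := Real.add_one_le_exp ((p : ℝ) * (Real.exp t - 1))
  refine pow_le_pow_left₀ ?_ (by linarith) _
  nlinarith [p.2.1, p.2.2, Real.exp_pos t, mul_nonneg p.2.1 (Real.exp_pos t).le]

/-! ### Edge boundaries as binomial counts -/

namespace SimpleGraph

variable {V : Type*}

/-- The pairs of vertices with one endpoint in `A` and the other outside. -/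
def cut (A : Finset V) : Set (Sym2 V) :=
  (fun e : V × V => s(e.1, e.2)) '' {e | e.1 ∈ A ∧ e.2 ∉ A}

theorem cut_subset (A : Finset V) : cut A ⊆ Sym2.diagSetᶜ := by
  rintro _ ⟨⟨a, b⟩, ⟨ha, hb⟩, rfl⟩
  have hab : a ≠ b := fun h => hb (h ▸ ha)
  simpa using hab

theorem injOn_cut (A : Finset V) :
    Set.InjOn (fun e : V × V => s(e.1, e.2)) {e | e.1 ∈ A ∧ e.2 ∉ A} := by
  rintro ⟨a, b⟩ ⟨ha, hb⟩ ⟨c, d⟩ ⟨hc, hd⟩ h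
  simp only [Sym2.eq_iff] at h
  rcases h with ⟨rfl, rfl⟩ | ⟨rfl, rfl⟩
  · rfl
  · exact absurd ha hd

variable [Fintype V]

theorem ncard_cut (A : Finset V) :
    (cut A).ncard = A.card * (Fintype.card V - A.card) := by
  classical
  rw [cut, (injOn_cut A).ncard_image, ← Finset.card_compl, ← Finset.card_product,
    ← Set.ncard_coe_finset]
  congr 1
  ext e
  simp

theorem card_edgeBoundary (G : SimpleGraph V) (A : Finset V) :
    (G.edgeBoundary A).card = (G.edgeSet ∩ cut A).ncard := by
  classical
  have : G.edgeSet ∩ cut A =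
      (fun e : V × V => s(e.1, e.2)) '' (G.edgeBoundary A : Set (V × V)) := by
    ext e
    constructor
    · rintro ⟨he, ⟨a, b⟩, hab, rfl⟩
      exact ⟨(a, b), by simpa [edgeBoundary] using ⟨he, hab⟩, rfl⟩
    · rintro ⟨⟨a, b⟩, hab, rfl⟩
      simp only [edgeBoundary, Finset.coe_filter, Finset.mem_univ, true_and,
        Set.mem_ofPred_eq] at hab
      exact ⟨hab.1, (a, b), hab.2, rfl⟩
  rw [this, Set.InjOn.ncard_image, Set.ncard_coe_finset]
  refine (injOn_cut A).mono fun e he => ?_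
  simp only [edgeBoundary, Finset.coe_filter, Finset.mem_univ, true_and,
        Set.mem_ofPred_eq] at he
  exact he.2

theorem card_edgeBoundary_singleton (G : SimpleGraph V) [DecidableRel G.Adj] (v : V) :
    (G.edgeBoundary {v}).card = G.degree v := by
  classical
  rw [← card_neighborFinset_eq_degree]
  refine Finset.card_nbij (fun e => e.2) ?_ ?_ ?_
  · rintro ⟨a, b⟩ h
    simp only [edgeBoundary, Finset.coe_filter, Finset.mem_singleton, Finset.mem_univ, true_and,
      Set.mem_ofPred_eq] at h
    obtain ⟨h, rfl, -⟩ := h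
    simpa using h
  · rintro ⟨a, b⟩ h ⟨c, d⟩ h' hbd
    simp only [edgeBoundary, Finset.coe_filter, Finset.mem_singleton, Finset.mem_univ, true_and,
      Set.mem_ofPred_eq] at h h'
    exact Prod.ext (h.2.1.trans h'.2.1.symm) hbd
  · intro w hw
    have hw' : G.Adj v w := by simpa using hw
    refine ⟨(v, w), ?_, rfl⟩
    simpa [edgeBoundary] using ⟨hw', hw'.ne'⟩

/-- Exponential Markov bound for edge boundaries in the binomial random graph. -/
theorem binomialRandom_edgeBoundary_le (p : unitInterval) (A : Finset V) (t B : ℝ) :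
    (binomialRandom V p).real {G | t * B ≤ t * (G.edgeBoundary A).card} ≤
      Real.exp (p * (A.card * (Fintype.card V - A.card)) * (Real.exp t - 1) - t * B) := by
  have key : (setBernoulli (Sym2.diagSetᶜ : Set (Sym2 V)) p).real
      {s | t * B ≤ t * (s ∩ cut A).ncard} ≤ Real.exp (-(t * B)) *
        mgf (fun s : Set (Sym2 V) => ((s ∩ cut A).ncard : ℝ))
          (setBernoulli (Sym2.diagSetᶜ : Set (Sym2 V)) p) t := by
    -- Applying Markov to `t * X` at parameter 1 leaves the sign of `t` free, so both tails are
    -- covered.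
    have h := measure_ge_le_exp_mul_mgf
      (μ := setBernoulli (Sym2.diagSetᶜ : Set (Sym2 V)) p)
      (X := fun s => t * ((s ∩ cut A).ncard : ℝ)) (t := 1) (t * B) zero_le_one .of_finite
    simpa [mgf] using h
  have hmono : (binomialRandom V p).real {G | t * B ≤ t * (G.edgeBoundary A).card} ≤
      (setBernoulli (Sym2.diagSetᶜ : Set (Sym2 V)) p).real
        {s | t * B ≤ t * (s ∩ cut A).ncard} := by
    rw [measureReal_def, binomialRandom_apply', ← measureReal_def]
    refine measureReal_mono ?_
    rintro _ ⟨G, hG, rfl⟩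
    simpa [← card_edgeBoundary] using hG
  refine (hmono.trans key).trans ?_
  refine (mul_le_mul_of_nonneg_left (mgf_ncard_inter_setBernoulli_le p (cut_subset A) t)
    (Real.exp_pos _).le).trans_eq ?_
  rw [← Real.exp_add, ncard_cut, Nat.cast_mul, Nat.cast_sub (Finset.card_le_univ A)]
  ring_nf

theorem isoperimetricConstant_le_minDegree (G : SimpleGraph V) [DecidableRel G.Adj]
    (hV : 2 ≤ Fintype.card V) : G.isoperimetricConstant ≤ G.minDegree := by
  have : Nonempty V := Fintype.card_pos_iff.1 (by omega)
  obtain ⟨v, hv⟩ := G.exists_minimal_degree_vertex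
  refine csInf_le ⟨0, ?_⟩ ⟨{v}, by simp, ?_, ?_⟩
  · rintro _ ⟨A, -, -, rfl⟩
    positivity
  · have : (2 : ℝ) ≤ Fintype.card V := by exact_mod_cast hV
    simp only [Finset.card_singleton, Nat.cast_one]
    linarith
  · simp [card_edgeBoundary_singleton, hv]

theorem le_isoperimetricConstant (G : SimpleGraph V) (hV : 2 ≤ Fintype.card V) {c : ℝ}
    (h : ∀ A : Finset V, A.Nonempty → (A.card : ℝ) ≤ (Fintype.card V : ℝ) / 2 →
      c * A.card ≤ (G.edgeBoundary A).card) : c ≤ G.isoperimetricConstant := by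
  have : Nonempty V := Fintype.card_pos_iff.1 (by omega)
  obtain ⟨v⟩ := this
  have h2 : (2 : ℝ) ≤ Fintype.card V := by exact_mod_cast hV
  refine le_csInf ⟨_, {v}, by simp, by simp; linarith, rfl⟩ ?_
  rintro _ ⟨A, hA, hA', rfl⟩
  rw [le_div_iff₀ (by exact_mod_cast hA.card_pos)]
  exact h A hA hA'

end SimpleGraph

/-- Turns the Chernoff exponent into a quadratic one. The bound log(1+y) ≥ 2y/(y+2) suffices at y =
d only for d ≤ 1; beyond that, log 2 is split off and the bound is used at y = (d-1)/2. -/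
theorem sq_div_three_le_mul_log_sub {d : ℝ} (h0 : 0 ≤ d) (h1 : d ≤ √3) :
    d ^ 2 / 3 ≤ (1 + d) * Real.log (1 + d) - d := by
  have hs : √3 ≤ 1.73206 := Real.sqrt_le_iff.2 ⟨by norm_num, by norm_num⟩
  rcases le_total d 1 with hd | hd
  · have hlog := mul_le_mul_of_nonneg_left (Real.le_log_one_add_of_nonneg h0)
      (by positivity : 0 ≤ 1 + d)
    have : 0 ≤ (1 + d) * (2 * d / (d + 2)) - d - d ^ 2 / 3 := by
      have : (1 + d) * (2 * d / (d + 2)) - d - d ^ 2 / 3 = d ^ 2 * (1 - d) / (3 * (d + 2)) := by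
        field_simp
        ring
      rw [this]
      have : 0 ≤ 1 - d := by linarith
      positivity
    linarith
  · have hlog2 : Real.log (1 + d) = Real.log 2 + Real.log (1 + (d - 1) / 2) := by
      rw [← Real.log_mul (by norm_num) (by linarith)]
      ring_nf
    have hlog : 0.6931 + 2 * (d - 1) / (d + 3) ≤ Real.log (1 + d) := by
      have h := Real.le_log_one_add_of_nonneg (x := (d - 1) / 2) (by linarith)
      have he : 2 * ((d - 1) / 2) / ((d - 1) / 2 + 2) = 2 * (d - 1) / (d + 3) := by
        field_simp
        ring
      rw [hlog2]
      linarith [Real.log_two_gt_d9]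
    have hmul := mul_le_mul_of_nonneg_left hlog (by positivity : 0 ≤ 1 + d)
    have hp : 0 ≤ (1 + d) * (0.6931 * (d + 3) + 2 * (d - 1)) - (d + d ^ 2 / 3) * (d + 3) := by
      have hd' : 0 ≤ 1.73206 - d := by linarith
      have hd1 : 0 ≤ d - 1 := by linarith
      nlinarith [mul_nonneg hd1 hd', mul_nonneg (mul_nonneg hd1 hd') h0]
    have : 0 ≤ (1 + d) * (0.6931 + 2 * (d - 1) / (d + 3)) - d - d ^ 2 / 3 := by
      have : (1 + d) * (0.6931 + 2 * (d - 1) / (d + 3)) - d - d ^ 2 / 3 =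
          ((1 + d) * (0.6931 * (d + 3) + 2 * (d - 1)) - (d + d ^ 2 / 3) * (d + 3)) / (d + 3) := by
        field_simp
        ring
      rw [this]
      positivity
    linarith

theorem tendsto_mul_exp_neg_mul_log {c : ℝ} (hc : 1 < c) :
    Tendsto (fun n : ℕ => (n : ℝ) * Real.exp (-(c * Real.log n))) atTop (𝓝 0) := by
  have h : Tendsto (fun n : ℕ => Real.exp (-((c - 1) * Real.log n))) atTop (𝓝 0) :=
    Real.tendsto_exp_neg_atTop_nhds_zero.comp
      ((Real.tendsto_log_atTop.comp tendsto_natCast_atTop_atTop).const_mul_atTop (by linarith))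
  refine h.congr' ?_
  filter_upwards [eventually_gt_atTop 0] with n hn
  have hn' : (0 : ℝ) < n := by exact_mod_cast hn
  nth_rw 2 [← Real.exp_log hn']
  rw [← Real.exp_add]
  ring_nf

/-- The logarithmic ratio in the limit superior is eventually at most a constant below one. -/
theorem exists_log_le_mul_of_limsup_lt_one (p : ℕ → unitInterval)
    (hp : limsup (fun n : ℕ => ENNReal.ofReal (Real.log n) / ENNReal.ofReal (n * (p n : ℝ)))
      atTop < 1) :
    ∃ r : ℝ, 0 < r ∧ r < 1 ∧ ∀ᶠ n : ℕ in atTop, 0 < n * (p n : ℝ) ∧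
      Real.log n ≤ r * (n * (p n : ℝ)) := by
  obtain ⟨r, hr0, hr1⟩ := exists_between hp
  have hr : r ≠ ⊤ := hr1.ne_top
  refine ⟨r.toReal, ENNReal.toReal_pos (ne_bot_of_gt hr0) hr, ?_, ?_⟩
  · simpa using (ENNReal.toReal_lt_toReal hr ENNReal.one_ne_top).2 hr1
  · filter_upwards [eventually_lt_of_limsup_lt hr0, eventually_ge_atTop 2] with n hn hn2
    have hlog : 0 < Real.log n := Real.log_pos (by exact_mod_cast hn2)
    have hpos : 0 < n * (p n : ℝ) := by
      -- If np = 0 the ratio is ⊤, since log n > 0.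
      by_contra hneg
      rw [ENNReal.ofReal_of_nonpos (not_lt.1 hneg), ENNReal.div_zero (by simpa using hlog)] at hn
      exact not_top_lt hn
    refine ⟨hpos, ?_⟩
    rw [← ENNReal.ofReal_div_of_pos hpos, ENNReal.ofReal_lt_iff_lt_toReal (by positivity) hr,
      div_lt_iff₀ hpos] at hn
    exact hn.le

/-! ### The two union bounds -/

namespace SimpleGraph

open scoped Classical in
theorem tendsto_binomialRandom_maxDegree (p : ℕ → unitInterval) {r : ℝ} (hr0 : 0 < r)
    (hr1 : r < 1) (hp : ∀ᶠ n : ℕ in atTop, 0 < n * (p n : ℝ) ∧ Real.log n ≤ r * (n * (p n : ℝ)))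
    {ε : ℝ} (hε : 0 < ε) (hε' : ε ≤ 1 / 2) :
    Tendsto (fun n : ℕ => (binomialRandom (Fin n) (p n)).real
      {G | ¬ (G.maxDegree : ℝ) ≤ n * (p n : ℝ) *
        (1 + √3 * (Real.log n / (n * (p n : ℝ))) ^ ((1 : ℝ) / 2 - ε))}) atTop (𝓝 0) := by
  have hc : 1 < r ^ (-(2 * ε)) :=
    Real.one_lt_rpow_of_pos_of_lt_one_of_neg hr0 hr1 (by linarith)
  refine squeeze_zero' (.of_forall fun n => measureReal_nonneg) ?_ (tendsto_mul_exp_neg_mul_log hc)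
  filter_upwards [hp, eventually_ge_atTop 2] with n ⟨hμ, hlog⟩ hn2
  set m : ℝ := n * (p n : ℝ) with hm
  have hL : 0 < Real.log n := Real.log_pos (by exact_mod_cast hn2)
  set x : ℝ := Real.log n / m with hx
  have hx0 : 0 < x := by positivity
  have hxr : x ≤ r := (div_le_iff₀ hμ).2 hlog
  set d : ℝ := √3 * x ^ ((1 : ℝ) / 2 - ε) with hd
  have hd0 : 0 ≤ d := by positivity
  have hd1 : d ≤ √3 := mul_le_of_le_one_right (by positivity)
    (Real.rpow_le_one hx0.le (by linarith) (by linarith))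
  -- The factor √3 in `d` cancels the 1/3.
  have hexp : r ^ (-(2 * ε)) * Real.log n ≤ m * (d ^ 2 / 3) := by
    have h1 : d ^ 2 / 3 = x * x ^ (-(2 * ε)) := by
      rw [hd, mul_pow, Real.sq_sqrt (by norm_num), ← Real.rpow_natCast, ← Real.rpow_mul hx0.le,
        show 1 / 2 - ε = (1 + -(2 * ε)) / 2 by ring, Nat.cast_ofNat, div_mul_cancel₀ _ two_ne_zero,
        Real.rpow_add hx0, Real.rpow_one]
      ring
    have h2 : m * x = Real.log n := by
      rw [hx]
      field_simp
    rw [h1, ← mul_assoc, h2, mul_comm]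
    exact mul_le_mul_of_nonneg_left
      (Real.rpow_le_rpow_of_nonpos hx0 hxr (by linarith)) hL.le
  have htail : ∀ v : Fin n, (binomialRandom (Fin n) (p n)).real
      {G | m * (1 + d) ≤ (G.edgeBoundary {v}).card} ≤
        Real.exp (-(r ^ (-(2 * ε)) * Real.log n)) := by
    intro v
    rcases hd0.eq_or_lt with hd00 | hdpos
    · rw [← hd00] at hexp
      have : 0 < r ^ (-(2 * ε)) * Real.log n := by positivity
      linarith
    have ht : 0 < Real.log (1 + d) := Real.log_pos (by linarith)
    have h := binomialRandom_edgeBoundary_le (p n) ({v} : Finset (Fin n)) (Real.log (1 + d))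
      (m * (1 + d))
    simp only [mul_le_mul_iff_right₀ ht] at h
    refine h.trans (Real.exp_le_exp.2 ?_)
    rw [Real.exp_log (by linarith)]
    have hh := mul_le_mul_of_nonneg_left (sq_div_three_le_mul_log_sub hd0 hd1) hμ.le
    have hpd : 0 ≤ (p n : ℝ) * d := mul_nonneg (p n).2.1 hd0
    simp only [Finset.card_singleton, Fintype.card_fin, Nat.cast_one]
    nlinarith
  calc _ ≤ (binomialRandom (Fin n) (p n)).real
        (⋃ v ∈ (Finset.univ : Finset (Fin n)), {G | m * (1 + d) ≤ (G.edgeBoundary {v}).card}) := by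
        refine measureReal_mono ?_ (measure_ne_top _ _)
        intro G hG
        have : Nonempty (Fin n) := ⟨⟨0, by omega⟩⟩
        obtain ⟨v, hv⟩ := G.exists_maximal_degree_vertex
        simp only [Set.mem_iUnion]
        refine ⟨v, Finset.mem_univ v, ?_⟩
        simp only [Set.mem_ofPred_eq, not_le] at hG ⊢
        rw [card_edgeBoundary_singleton, ← hv]
        exact hG.le
    _ ≤ _ := measureReal_biUnion_finset_le _ _
    _ ≤ ∑ v : Fin n, Real.exp (-(r ^ (-(2 * ε)) * Real.log n)) :=
        Finset.sum_le_sum fun v _ => htail v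
    _ = _ := by simp

theorem tendsto_binomialRandom_isoperimetricConstant (p : ℕ → unitInterval) {r : ℝ} (hr0 : 0 < r)
    (hr1 : r < 1)
    (hp : ∀ᶠ n : ℕ in atTop, 0 < n * (p n : ℝ) ∧ Real.log n ≤ r * (n * (p n : ℝ))) :
    ∃ α : ℝ, 0 < α ∧ Tendsto (fun n : ℕ => (binomialRandom (Fin n) (p n)).real
      {G | ¬ α * (n * (p n : ℝ)) ≤ G.isoperimetricConstant}) atTop (𝓝 0) := by
  -- Chosen so that (1-c)² - c ≥ 1 - 4c = (1+r)/2 > r; dividing (1+r)/2 by r gives ρ > 1.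
  set c : ℝ := (1 - r) / 8 with hc
  have hc0 : 0 < c := by rw [hc]; linarith
  have hc1 : c < 1 / 8 := by rw [hc]; linarith
  set t : ℝ := -Real.log c with ht
  have ht0 : 0 < t := by
    rw [ht, neg_pos]
    exact Real.log_neg hc0 (by linarith)
  have htc : Real.exp (-t) = c := by rw [ht, neg_neg, Real.exp_log hc0]
  set ρ : ℝ := (1 + r) / (2 * r) with hρ
  have hρ1 : 1 < ρ := by
    rw [hρ, one_lt_div (by positivity)]
    linarith
  refine ⟨c / t, by positivity, ?_⟩
  have hlim : Tendsto (fun n : ℕ => (Real.exp (n * Real.exp (-(ρ * Real.log n))) - 1) +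
      2 * Real.exp (-(c / 4 * Real.log n))) atTop (𝓝 0) := by
    have h1 := (Real.continuous_exp.tendsto 0).comp (tendsto_mul_exp_neg_mul_log hρ1)
    have h2 : Tendsto (fun n : ℕ => Real.exp (-(c / 4 * Real.log n))) atTop (𝓝 0) :=
      Real.tendsto_exp_neg_atTop_nhds_zero.comp
        ((Real.tendsto_log_atTop.comp tendsto_natCast_atTop_atTop).const_mul_atTop (by positivity))
    simpa using (h1.sub_const 1).add (h2.const_mul 2)
  have hQ : ∀ᶠ n : ℕ in atTop, 2 * Real.exp (-(c / 4 * Real.log n)) ≤ 1 := by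
    have h2 : Tendsto (fun n : ℕ => 2 * Real.exp (-(c / 4 * Real.log n))) atTop (𝓝 (2 * 0)) :=
      (Real.tendsto_exp_neg_atTop_nhds_zero.comp ((Real.tendsto_log_atTop.comp
        tendsto_natCast_atTop_atTop).const_mul_atTop (by positivity))).const_mul 2
    exact (h2.eventually_lt_const (by norm_num)).mono fun n hn => hn.le
  refine squeeze_zero' (.of_forall fun n => measureReal_nonneg) ?_ hlim
  filter_upwards [hp, hQ, eventually_ge_atTop 2] with n ⟨hμ, hlog⟩ hQ1 hn2
  set m : ℝ := n * (p n : ℝ) with hm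
  have hn0 : (0 : ℝ) < n := by positivity
  have hL : 0 < Real.log n := Real.log_pos (by exact_mod_cast hn2)
  set q : ℝ := Real.exp (-(ρ * Real.log n)) with hq
  set Q : ℝ := Real.exp (-(c / 4 * Real.log n)) with hQdef
  set S : Finset (Finset (Fin n)) :=
    Finset.univ.filter fun A => A.Nonempty ∧ (A.card : ℝ) ≤ n / 2 with hS
  have htail : ∀ A ∈ S, (binomialRandom (Fin n) (p n)).real
      {G | ((G.edgeBoundary A).card : ℝ) ≤ c / t * m * A.card} ≤ q ^ A.card + Q ^ n := by
    intro A hA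
    obtain ⟨hA0, hA1⟩ := (Finset.mem_filter.1 hA).2
    have hk0 : (0 : ℝ) < A.card := by exact_mod_cast hA0.card_pos
    have h := binomialRandom_edgeBoundary_le (p n) A (-t) (c / t * m * A.card)
    simp only [neg_mul, neg_le_neg_iff, mul_le_mul_iff_right₀ ht0] at h
    refine h.trans ?_
    rw [htc, Fintype.card_fin]
    have he : (p n : ℝ) * (A.card * (n - A.card)) * (c - 1) - -(t * (c / t * m * A.card)) =
        -(m * A.card * ((1 - A.card / n) * (1 - c) - c)) := by
      rw [hm]
      field_simp
      ring
    rw [he]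
    -- Small sets need the full strength of r < 1, as they have nearly k(n-k) ≈ kn potential
    -- boundary edges; for large ones the crude factor 1/4 is enough.
    rcases le_total (A.card : ℝ) (c * n) with hk | hk
    · have hkn : (A.card : ℝ) / n ≤ c := (div_le_iff₀ hn0).2 hk
      have h1 : (1 + r) / 2 ≤ (1 - A.card / n) * (1 - c) - c := by
        have : (1 - c) * (1 - c) ≤ (1 - A.card / n) * (1 - c) :=
          mul_le_mul_of_nonneg_right (by linarith) (by linarith)
        have hr : r = 1 - 8 * c := by rw [hc]; ring
        nlinarith
      have h2 : ρ * Real.log n ≤ m * ((1 + r) / 2) := by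
        have h3 : ρ * (r * m) = m * ((1 + r) / 2) := by
          rw [hρ]
          field_simp
        rw [← h3]
        exact mul_le_mul_of_nonneg_left hlog (by linarith)
      have h4 : Real.exp (-(m * A.card * ((1 - A.card / n) * (1 - c) - c))) ≤ q ^ A.card := by
        rw [hq, ← Real.exp_nat_mul]
        refine Real.exp_le_exp.2 ?_
        have h5 := mul_le_mul_of_nonneg_left h1 (by positivity : 0 ≤ m * A.card)
        have h6 := mul_le_mul_of_nonneg_left h2 hk0.le
        nlinarith
      have : 0 ≤ Q ^ n := by positivity
      linarith
    · have hkn : (A.card : ℝ) / n ≤ 1 / 2 := (div_le_iff₀ hn0).2 (by linarith)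
      have h1 : 1 / 4 ≤ (1 - A.card / n) * (1 - c) - c := by
        have : (1 / 2) * (1 - c) ≤ (1 - A.card / n) * (1 - c) :=
          mul_le_mul_of_nonneg_right (by linarith) (by linarith)
        linarith
      have hlog' : Real.log n ≤ m := hlog.trans (mul_le_of_le_one_left hμ.le hr1.le)
      have h4 : Real.exp (-(m * A.card * ((1 - A.card / n) * (1 - c) - c))) ≤ Q ^ n := by
        rw [hQdef, ← Real.exp_nat_mul]
        refine Real.exp_le_exp.2 ?_
        have h5 := mul_le_mul_of_nonneg_left h1 (by positivity : 0 ≤ m * A.card)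
        have h6 : Real.log n * (c * n) ≤ m * A.card :=
          mul_le_mul hlog' hk (by positivity) hμ.le
        nlinarith
      have : 0 ≤ q ^ A.card := by positivity
      linarith
  calc _ ≤ (binomialRandom (Fin n) (p n)).real
        (⋃ A ∈ S, {G | ((G.edgeBoundary A).card : ℝ) ≤ c / t * m * A.card}) := by
        refine measureReal_mono ?_ (measure_ne_top _ _)
        intro G hG
        by_contra hcon
        refine hG (le_isoperimetricConstant G (by simpa using hn2) fun A hA hA' => ?_)
        simp only [Set.mem_iUnion, Set.mem_ofPred_eq, not_exists, not_le] at hcon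
        refine (hcon A ?_).le
        rw [Fintype.card_fin] at hA'
        simp [hS, hA, hA']
    _ ≤ _ := measureReal_biUnion_finset_le _ _
    _ ≤ ∑ A ∈ S, (q ^ A.card + Q ^ n) := Finset.sum_le_sum htail
    -- Dropping the size restriction lets the binomial theorem sum q^|A| in closed form.
    _ ≤ ∑ A ∈ (Finset.univ : Finset (Finset (Fin n))).erase ∅, (q ^ A.card + Q ^ n) := by
        refine Finset.sum_le_sum_of_subset_of_nonneg ?_ fun _ _ _ => by positivity
        intro A hA
        simpa using (Finset.mem_filter.1 hA).2.1.ne_empty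
    _ = (1 + q) ^ n - 1 + ((2 ^ n - 1 : ℕ) : ℝ) * Q ^ n := by
        have h := Finset.sum_pow_mul_eq_add_pow q 1 (Finset.univ : Finset (Fin n))
        simp only [one_pow, mul_one, Finset.powerset_univ, Finset.card_univ,
          Fintype.card_fin] at h
        rw [Finset.sum_add_distrib, Finset.sum_const, nsmul_eq_mul,
          Finset.card_erase_of_mem (Finset.mem_univ _), add_comm 1 q, ← h,
          ← Finset.add_sum_erase _ _ (Finset.mem_univ ∅)]
        simp
    _ ≤ _ := by
        have h1 : (1 + q) ^ n ≤ Real.exp (n * q) := by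
          rw [Real.exp_nat_mul]
          exact pow_le_pow_left₀ (by positivity) (by linarith [Real.add_one_le_exp q]) _
        have h2 : ((2 ^ n - 1 : ℕ) : ℝ) * Q ^ n ≤ 2 * Q := by
          calc ((2 ^ n - 1 : ℕ) : ℝ) * Q ^ n ≤ 2 ^ n * Q ^ n := by
                refine mul_le_mul_of_nonneg_right ?_ (by positivity)
                exact_mod_cast Nat.sub_le _ _
            _ = (2 * Q) ^ n := (mul_pow _ _ _).symm
            _ ≤ 2 * Q := pow_le_of_le_one (by positivity) hQ1 (by omega)
        linarith

end SimpleGraph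

open scoped Classical in
theorem lemma2 (p : ℕ → unitInterval)
    (hp : Filter.limsup
      (fun n : ℕ => ENNReal.ofReal (Real.log n) / ENNReal.ofReal (n * (p n : ℝ)))
      Filter.atTop < 1) :
    ∃ α : ℝ, 0 < α ∧ ∀ ε : ℝ, 0 < ε → ε ≤ 1 / 2 →
      AsymptoticallyAlmostSurely p fun n G =>
        α * (n * (p n : ℝ)) ≤ G.isoperimetricConstant ∧
        G.isoperimetricConstant ≤ (G.minDegree : ℝ) ∧
        G.minDegree ≤ G.maxDegree ∧
        (G.maxDegree : ℝ) ≤ n * (p n : ℝ) *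
          (1 + √3 * (Real.log n / (n * (p n : ℝ))) ^ ((1 : ℝ) / 2 - ε)) := by
  obtain ⟨r, hr0, hr1, hr⟩ := exists_log_le_mul_of_limsup_lt_one p hp
  obtain ⟨α, hα, hiso⟩ :=
    SimpleGraph.tendsto_binomialRandom_isoperimetricConstant p hr0 hr1 hr
  refine ⟨α, hα, fun ε hε hε' => ?_⟩
  have hdeg := SimpleGraph.tendsto_binomialRandom_maxDegree p hr0 hr1 hr hε hε'
  have hlim := ENNReal.Tendsto.sub (tendsto_const_nhds (x := (1 : ENNReal)))
    (ENNReal.tendsto_ofReal (hiso.add hdeg)) (.inl ENNReal.one_ne_top)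
  simp only [add_zero, ENNReal.ofReal_zero, tsub_zero] at hlim
  refine tendsto_of_tendsto_of_tendsto_of_le_of_le' hlim tendsto_const_nhds ?_
    (.of_forall fun n => prob_le_one)
  -- For n ≥ 2 singletons are admissible in i(G), so the middle inequalities always hold and only
  -- two events can fail.
  filter_upwards [eventually_ge_atTop 2] with n hn
  rw [tsub_le_iff_right, ENNReal.ofReal_add measureReal_nonneg measureReal_nonneg,
    ofReal_measureReal, ofReal_measureReal, ← measure_univ (μ := SimpleGraph.binomialRandom (Fin n) (p n))]
  refine (measure_mono ?_).trans ((measure_union_le _ _).trans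
    (add_le_add_right (measure_union_le _ _) _))
  intro G _
  by_cases h1 : α * (n * (p n : ℝ)) ≤ G.isoperimetricConstant
  · by_cases h2 : (G.maxDegree : ℝ) ≤ n * (p n : ℝ) *
          (1 + √3 * (Real.log n / (n * (p n : ℝ))) ^ ((1 : ℝ) / 2 - ε))
    · exact .inl ⟨h1, G.isoperimetricConstant_le_minDegree (by simpa using hn),
        G.minDegree_le_maxDegree, h2⟩
    · exact .inr (.inr h2)
  · exact .inr (.inl h1)
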